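/- Let $(X,d)$ be a metric space that is positive definite, i.e. for every finite $B\subset X$ the matrix $(e^{-d(x,y)})_{x,y\in B}$ is (strictly) positive definite. Let $\mathcal{H}_X$ be the real reproducing kernel Hilbert space of the kernel $e^{-d(x,y)}$ on $X$. Let $\mathcal{W}_X$ be the completion of the space of finitely supported signed measures on $X$ with respect to the inner product $\left\langle \sum_x u_x\delta_x,\sum_y v_y\delta_y\right\rangle_{\mathcal{W}_X}=\sum_{x,y}u_xv_y e^{-d(x,y)}$, let $Z_X:\mathcal{W}_X\to\mathcal{H}_X$ be the continuous linear extension of $\delta_x\mapsto e^{-d(x,\cdot)}$, and let $\langle w,h\rangle:=\langle Z_Xw,h\rangle_{\mathcal{H}_X}$ for $w\in\mathcal{W}_X$, $h\in\mathcal{H}_X$ (so that $\langle\sum_i m_i\delta_{x_i},h\rangle=\sum_i m_ih(x_i)$). For every finite nonempty $B\subset X$ there is exactly one measure $w_{B,+}$ that maximizes $$\frac{\left(\sum_{x}w_x\right)^2}{\sum_{x,y}e^{-d(x,y)}w_xw_y}$$ among all nonzero measures $w=\sum_{x\in B}w_x\delta_x$ with all $w_x\ge 0$, and whose total mass equals the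 maximum; put $w_{\emptyset,+}:=0$. For every compact $A\subset X$ the net $(w_{B,+})_B$, indexed by the finite subsets $B$ of $A$ ordered by inclusion, converges in $\mathcal{W}_X$; let $w_{A,+}$ be its limit (the diversifier of $A$). Then for each $h\in\mathcal{H}_X$ the function $A\mapsto\langle w_{A,+},h\rangle$ on the set of compact subsets of $X$ is continuous with respect to the Hausdorff distance $d_H(A,B)=\max\{\sup_{a\in A}d(a,B),\sup_{b\in B}d(b,A)\}$ (where $d_H(\emptyset,A)=\infty$ for $A\neq\emptyset$). -/

import Mathlib

namespace Diversity

/-- The similarity matrix `(e^{-d(x,y)})_{x,y ∈ B}` of a finite subset `B` of a metric space. -/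
noncomputable def similarityMatrix {X : Type*} [MetricSpace X] (B : Finset X) : Matrix B B ℝ :=
  Matrix.of fun x y => Real.exp (-dist (x : X) (y : X))

/-- A metric space is positive definite if the similarity matrix of each of its finite subsets
is (strictly) positive definite. -/
class PositiveDefinite (X : Type*) [MetricSpace X] : Prop where
  posDef : ∀ B : Finset X, (similarityMatrix B).PosDef

/-- The form `⟨∑ u_x δ_x, ∑ v_y δ_y⟩ = ∑ u_x v_y e^{-d(x,y)}` on finitely supported
signed measures. A finitely supported signed measure is given by its finitely supported
family of point masses. -/
noncomputable def kernelForm {X : Type*} [MetricSpace X] (u v : X →₀ ℝ) : ℝ :=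
  u.sum fun x a => v.sum fun y b => a * b * Real.exp (-dist x y)

theorem kernelForm_pos {X : Type*} [MetricSpace X] [PositiveDefinite X] {u : X →₀ ℝ}
    (hu : u ≠ 0) : 0 < kernelForm u u := by
  have h := (PositiveDefinite.posDef (X := X) u.support)
  have hne : (fun x : u.support => u x) ≠ 0 := by
    intro h0
    apply hu
    ext x
    by_cases hx : x ∈ u.support
    · exact congrFun h0 ⟨x, hx⟩
    · simpa using hx
  have h2 := h.dotProduct_mulVec_pos hne
  refine h2.trans_eq ?_
  simp only [kernelForm, Finsupp.sum, dotProduct, Matrix.mulVec, similarityMatrix,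
    Matrix.of_apply, star_trivial]
  rw [← Finset.sum_coe_sort u.support]
  refine Finset.sum_congr rfl fun x _ => ?_
  rw [← Finset.sum_coe_sort u.support, Finset.mul_sum]
  exact Finset.sum_congr rfl fun y _ => by ring

theorem kernelForm_nonneg {X : Type*} [MetricSpace X] [PositiveDefinite X] (u : X →₀ ℝ) :
    0 ≤ kernelForm u u := by
  by_cases hu : u = 0
  · simp [hu, kernelForm]
  · exact (kernelForm_pos hu).le

/-! ### The weighting space -/

/-- The space of finitely supported signed measures on `X`; it carries the inner product
`kernelForm`. -/
def FM (X : Type*) : Type _ := X →₀ ℝ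

noncomputable instance (X : Type*) : AddCommGroup (FM X) := inferInstanceAs (AddCommGroup (X →₀ ℝ))

noncomputable instance (X : Type*) : Module ℝ (FM X) := inferInstanceAs (Module ℝ (X →₀ ℝ))

/-- A family of point masses, viewed as an element of `FM X`. -/
noncomputable def FM.of (X : Type*) : (X →₀ ℝ) ≃ₗ[ℝ] FM X := LinearEquiv.refl ℝ (X →₀ ℝ)

noncomputable instance FM.core (X : Type*) [MetricSpace X] [PositiveDefinite X] :
    InnerProductSpace.Core ℝ (FM X) where
  inner u v := kernelForm ((FM.of X).symm u) ((FM.of X).symm v)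
  conj_inner_symm u v := by
    simp only [kernelForm, conj_trivial]
    rw [Finsupp.sum_comm]
    simp only [dist_comm, mul_comm]
  re_inner_nonneg u := kernelForm_nonneg _
  add_left u v w := by
    simp only [kernelForm, map_add]
    rw [Finsupp.sum_add_index'] <;> simp [← Finsupp.sum_add, add_mul]
  smul_left u v r := by
    simp only [kernelForm, map_smul]
    rw [Finsupp.sum_smul_index] <;> simp [Finsupp.mul_sum, ← mul_assoc]
  definite u hu := by
    by_contra h
    exact (kernelForm_pos (u := (FM.of X).symm u) (by simpa using h)).ne' hu

noncomputable instance (X : Type*) [MetricSpace X] [PositiveDefinite X] :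
    NormedAddCommGroup (FM X) := (FM.core X).toNormedAddCommGroup

noncomputable instance (X : Type*) [MetricSpace X] [PositiveDefinite X] :
    InnerProductSpace ℝ (FM X) := InnerProductSpace.ofCore (FM.core X).toCore

theorem FM.inner_of {X : Type*} [MetricSpace X] [PositiveDefinite X] (u v : X →₀ ℝ) :
    inner ℝ (FM.of X u) (FM.of X v) = kernelForm u v := rfl

/-- The weighting space of `X`: the completion of `FM X` for the inner product `kernelForm`. -/
abbrev WeightingSpace (X : Type*) [MetricSpace X] [PositiveDefinite X] : Type _ :=
  UniformSpace.Completion (FM X)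

/-- A finitely supported signed measure as an element of the weighting space. -/
noncomputable def toWeighting {X : Type*} [MetricSpace X] [PositiveDefinite X] (u : X →₀ ℝ) :
    WeightingSpace X :=
  ((FM.of X u : FM X) : UniformSpace.Completion (FM X))

/-! ### The reproducing kernel Hilbert space of `e^{-d}` -/

/-- The kernel `e^{-d(x,y)}`; the real number `c` is viewed as the operator `v ↦ c v` on `ℝ`. -/
noncomputable def expKernel (X : Type*) [MetricSpace X] : Matrix X X (ℝ →L[ℝ] ℝ) :=
  Matrix.of fun x y => Real.exp (-dist x y) • ContinuousLinearMap.id ℝ ℝ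

instance expKernel_posSemidef (X : Type*) [MetricSpace X] [PositiveDefinite X] :
    Fact (expKernel X).PosSemidef := by
  have key := (RKHS.posSemidef_tfae (K := expKernel X)).out 0 2
  refine ⟨key.mpr ⟨?_, fun u => ?_⟩⟩
  · ext x y
    have h1 : star (ContinuousLinearMap.id ℝ ℝ) = ContinuousLinearMap.id ℝ ℝ :=
      star_one (R := ℝ →L[ℝ] ℝ)
    simp [expKernel, Matrix.conjTranspose_apply, dist_comm, h1]
  · have h := kernelForm_nonneg u
    refine h.trans_eq ?_
    simp only [kernelForm, expKernel, Finsupp.sum, RCLike.re_to_real, Matrix.of_apply]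
    refine Finset.sum_congr rfl fun x _ => Finset.sum_congr rfl fun y _ => ?_
    simp [dist_comm x y]
    ring

/-- The reproducing kernel Hilbert space of the kernel `e^{-d}`. -/
abbrev KernelSpace (X : Type*) [MetricSpace X] [PositiveDefinite X] : Type _ :=
  RKHS.OfKernel (expKernel X)

/-- The function `y ↦ e^{-d(x,y)}` as an element of the reproducing kernel Hilbert space. -/
noncomputable def kernelAt {X : Type*} [MetricSpace X] [PositiveDefinite X] (x : X) :
    KernelSpace X :=
  RKHS.kerFun (KernelSpace X) x 1

theorem kernelAt_apply {X : Type*} [MetricSpace X] [PositiveDefinite X] (x y : X) :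
    kernelAt x y = Real.exp (-dist x y) := by
  rw [kernelAt, RKHS.kerFun_apply, RKHS.OfKernel.kernel_ofKernel]
  simp [expKernel, dist_comm]

theorem inner_kernelAt {X : Type*} [MetricSpace X] [PositiveDefinite X] (x : X)
    (h : KernelSpace X) : inner ℝ (kernelAt x) h = h x := by
  rw [kernelAt, RKHS.kerFun_inner]
  simp

/-- The map `∑ m_i δ_{x_i} ↦ ∑ m_i e^{-d(x_i, ·)}` on finitely supported signed measures. -/
noncomputable def similarityLin (X : Type*) [MetricSpace X] [PositiveDefinite X] :
    FM X →ₗ[ℝ] KernelSpace X :=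
  (Finsupp.linearCombination ℝ (kernelAt (X := X))) ∘ₗ (FM.of X).symm.toLinearMap

theorem similarityLin_of {X : Type*} [MetricSpace X] [PositiveDefinite X] (u : X →₀ ℝ) :
    similarityLin X (FM.of X u) = u.sum fun x a => a • kernelAt x := by
  simp [similarityLin, Finsupp.linearCombination_apply]

/-- The isometry `Z_X` on finitely supported signed measures. -/
noncomputable def similarityIso (X : Type*) [MetricSpace X] [PositiveDefinite X] :
    FM X →ₗᵢ[ℝ] KernelSpace X :=
  (similarityLin X).isometryOfInner fun u v => by
    obtain ⟨u, rfl⟩ := (FM.of X).surjective u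
    obtain ⟨v, rfl⟩ := (FM.of X).surjective v
    rw [FM.inner_of, similarityLin_of, similarityLin_of, kernelForm]
    simp only [Finsupp.sum_inner, Finsupp.inner_sum, inner_smul_left, inner_smul_right,
      inner_kernelAt, kernelAt_apply, conj_trivial]
    simp only [Finsupp.sum, Finset.mul_sum]
    rw [Finset.sum_comm]
    refine Finset.sum_congr rfl fun x _ => Finset.sum_congr rfl fun y _ => ?_
    rw [dist_comm y x]
    ring

/-- The map `Z_X` from the weighting space to the reproducing kernel Hilbert space, i.e. the
extension by continuity of the map on finitely supported signed measures. -/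
noncomputable def similarityMap (X : Type*) [MetricSpace X] [PositiveDefinite X] :
    WeightingSpace X →L[ℝ] KernelSpace X :=
  (similarityIso X).toContinuousLinearMap.extend
    (UniformSpace.Completion.toComplL : FM X →L[ℝ] UniformSpace.Completion (FM X))

theorem similarityMap_toWeighting {X : Type*} [MetricSpace X] [PositiveDefinite X]
    (u : X →₀ ℝ) : similarityMap X (toWeighting u) = u.sum fun x a => a • kernelAt x := by
  rw [← similarityLin_of]
  exact ContinuousLinearMap.extend_eq _ UniformSpace.Completion.denseRange_coe
    (UniformSpace.Completion.isUniformInducing_coe _) (FM.of X u)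

/-- The pairing `⟨w, h⟩ = ⟨Z_X w, h⟩` between the weighting space and the reproducing kernel
Hilbert space. -/
noncomputable def pairing {X : Type*} [MetricSpace X] [PositiveDefinite X]
    (w : WeightingSpace X) (h : KernelSpace X) : ℝ :=
  inner ℝ (similarityMap X w) h

/-- On finitely supported measures the pairing is integration: `⟨∑ m_i δ_{x_i}, h⟩ = ∑ m_i h(x_i)`. -/
theorem pairing_toWeighting {X : Type*} [MetricSpace X] [PositiveDefinite X]
    (u : X →₀ ℝ) (h : KernelSpace X) :
    pairing (toWeighting u) h = u.sum fun x a => a * h x := by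
  rw [pairing, similarityMap_toWeighting]
  simp [Finsupp.sum_inner, inner_smul_left, inner_kernelAt]

/-! ### The diversifier -/

/-- The total mass `⟨u, 1⟩`. -/
noncomputable def mass {X : Type*} (u : X →₀ ℝ) : ℝ := u.sum fun _ a => a

/-- The objective `⟨u, 1⟩² / ⟨u, u⟩`. -/
noncomputable def diversity {X : Type*} [MetricSpace X] (u : X →₀ ℝ) : ℝ :=
  mass u ^ 2 / kernelForm u u

/-- `w` is a nonzero nonnegative measure on the finite set `B`. -/
def Feasible {X : Type*} (B : Finset X) (w : X →₀ ℝ) : Prop :=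
  w.support ⊆ B ∧ 0 ≤ w ∧ w ≠ 0

/-- `w` is the diversifier of the finite set `B`: it maximizes `⟨u, 1⟩² / ⟨u, u⟩` among the nonzero
nonnegative measures `u` on `B`, and is normalized so that `⟨w, 1⟩` is the maximum. -/
def IsFiniteDiversifier {X : Type*} [MetricSpace X] (B : Finset X) (w : X →₀ ℝ) : Prop :=
  Feasible B w ∧ (∀ u, Feasible B u → diversity u ≤ diversity w) ∧ mass w = diversity w

open Classical in
/-- The diversifier `w_{B,+}` of a finite set `B` (and `0` if `B` is empty). -/
noncomputable def finiteDiversifier {X : Type*} [MetricSpace X] (B : Finset X) : X →₀ ℝ :=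
  if h : ∃ w, IsFiniteDiversifier B w then h.choose else 0

/-- The net `B ↦ w_{B,+}` in the weighting space, indexed by the finite subsets of `A`
ordered by inclusion. -/
noncomputable def diversifierNet {X : Type*} [MetricSpace X] [PositiveDefinite X] (A : Set X)
    (B : {B : Finset X // (B : Set X) ⊆ A}) : WeightingSpace X :=
  toWeighting (finiteDiversifier B.1)

/-- The diversifier `w_{A,+}`: the limit of the net of diversifiers of finite subsets of `A`. -/
noncomputable def diversifier {X : Type*} [MetricSpace X] [PositiveDefinite X] (A : Set X) :
    WeightingSpace X :=
  Filter.limUnder Filter.atTop (diversifierNet A)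

end Diversity

/-! Everything rests on one inequality. Write `w_B` for the diversifier of a finite set `B`.
First-order optimality and the normalization give `⟨w_B, w_B⟩ = mass w_B` and potential at least `1`
on `B`. By the triangle inequality, the potential of a nonnegative measure drops by a factor of at
most `e^{-r}` over distance `r`. So if `C` lies within `r` of `B`, integrating the potential of
`w_B` against `w_C ≥ 0` gives `e^{-r} ‖w_C‖² ≤ ⟨w_B, w_C⟩` (`exp_neg_mul_norm_sq_le_inner`).

With `r = 0` this makes the squared norms increase along inclusions and control distances; a finite
net of a compact set bounds them, so the net is Cauchy. The inequality survives the limit, and using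
it in both directions for two compact sets at Hausdorff distance less than `r` yields `‖w_A' - w_A‖²
≤ (1 - e^{-r}) (‖w_A'‖² + ‖w_A‖²)`. Hence the diversifier is norm continuous, and so is each
pairing. -/

namespace Diversity

/-! ### Total mass -/

section FiniteMeasures

variable {X : Type*}

theorem mass_add (u v : X →₀ ℝ) : mass (u + v) = mass u + mass v :=
  Finsupp.sum_add_index' (fun _ => rfl) fun _ _ _ => rfl

theorem mass_smul (c : ℝ) (u : X →₀ ℝ) : mass (c • u) = c * mass u := by
  rw [mass, Finsupp.sum_smul_index fun _ => rfl, mass, Finsupp.mul_sum]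

theorem mass_nonneg {u : X →₀ ℝ} (hu : 0 ≤ u) : 0 ≤ mass u :=
  Finset.sum_nonneg fun x _ => hu x

theorem mass_pos {u : X →₀ ℝ} (hu : 0 ≤ u) (h0 : u ≠ 0) : 0 < mass u := by
  refine Finset.sum_pos (fun x hx => lt_of_le_of_ne (hu x) ?_) (Finsupp.support_nonempty_iff.2 h0)
  exact (Finsupp.mem_support_iff.1 hx).symm

theorem mass_eq_sum {B : Finset X} {u : X →₀ ℝ} (hu : u.support ⊆ B) :
    mass u = ∑ x ∈ B, u x :=
  Finsupp.sum_of_support_subset u hu _ fun _ _ => rfl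

end FiniteMeasures

/-! ### Potentials, and energy minimization on a finite set -/

variable {X : Type*} [MetricSpace X]

/-- The potential `Z_X u`, evaluated at a point. -/
noncomputable def potential (u : X →₀ ℝ) (y : X) : ℝ :=
  u.sum fun x a => a * Real.exp (-dist x y)

theorem kernelForm_eq_sum_potential (u v : X →₀ ℝ) :
    kernelForm u v = v.sum fun y b => b * potential u y := by
  rw [kernelForm, Finsupp.sum_comm]
  refine Finset.sum_congr rfl fun y _ => ?_
  simp only [potential, Finsupp.mul_sum]
  exact Finset.sum_congr rfl fun x _ => by ring

theorem kernelForm_single_right (u : X →₀ ℝ) (y : X) :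
    kernelForm u (Finsupp.single y 1) = potential u y := by
  rw [kernelForm_eq_sum_potential, Finsupp.sum_single_index] <;> simp

/-- The triangle inequality, summed over the point masses; nonnegativity of `u` is essential. -/
theorem exp_neg_dist_mul_potential_le {u : X →₀ ℝ} (hu : 0 ≤ u) (x y : X) :
    Real.exp (-dist x y) * potential u y ≤ potential u x := by
  rw [potential, potential, Finsupp.mul_sum]
  refine Finset.sum_le_sum fun z _ => ?_
  have h : Real.exp (-dist x y) * Real.exp (-dist z y) ≤ Real.exp (-dist z x) := by
    rw [← Real.exp_add, Real.exp_le_exp]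
    linarith [dist_triangle z y x, dist_comm x y]
  nlinarith [mul_le_mul_of_nonneg_left h (hu z)]

theorem mul_mass_le_kernelForm {u v : X →₀ ℝ} {c : ℝ} (hv : 0 ≤ v)
    (h : ∀ x ∈ v.support, c ≤ potential u x) : c * mass v ≤ kernelForm u v := by
  rw [kernelForm_eq_sum_potential, mass, Finsupp.mul_sum]
  refine Finset.sum_le_sum fun x hx => ?_
  exact (mul_comm c (v x)).trans_le (mul_le_mul_of_nonneg_left (h x hx) (hv x))

theorem exists_minimizer_kernelForm {B : Finset X} (hB : B.Nonempty) :
    ∃ u : X →₀ ℝ, u.support ⊆ B ∧ 0 ≤ u ∧ mass u = 1 ∧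
      ∀ v : X →₀ ℝ, v.support ⊆ B → 0 ≤ v → mass v = 1 → kernelForm u u ≤ kernelForm v v := by
  classical
  have : Nonempty B := hB.to_subtype
  -- Extension by zero identifies the probability measures on `B` with the standard simplex, which
  -- is compact.
  let φ : (B → ℝ) → (X →₀ ℝ) := fun p =>
    Finsupp.onFinset B (fun x => if hx : x ∈ B then p ⟨x, hx⟩ else 0) fun x hx => by
      by_contra h
      simp [h] at hx
  have hφB : ∀ p, (φ p).support ⊆ B := fun p => Finsupp.support_onFinset_subset
  have hφa : ∀ p (x : B), φ p x = p x := fun p x => by simp [φ]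
  have hφ0 : ∀ p, (∀ x, 0 ≤ p x) → 0 ≤ φ p := fun p hp x => by
    by_cases hx : x ∈ B
    · simpa [φ, hx] using hp ⟨x, hx⟩
    · simp [φ, hx]
  have hφm : ∀ p, mass (φ p) = ∑ x, p x := fun p => by
    rw [mass_eq_sum (hφB p), ← Finset.sum_coe_sort B]
    exact Finset.sum_congr rfl fun x _ => hφa p x
  have hφr : ∀ v : X →₀ ℝ, v.support ⊆ B → φ (fun x => v x) = v := fun v hv => by
    ext x
    by_cases hx : x ∈ B
    · simp [φ, hx]
    · simpa [φ, hx, eq_comm] using fun h => hx (hv (Finsupp.mem_support_iff.2 h))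
  have hcont : Continuous fun p => kernelForm (φ p) (φ p) := by
    have : ∀ p, kernelForm (φ p) (φ p) =
        ∑ x : B, ∑ y : B, p x * p y * Real.exp (-dist (x : X) (y : X)) := fun p => by
      rw [kernelForm, Finsupp.sum_of_support_subset _ (hφB p) _ (by simp), ← Finset.sum_coe_sort B]
      refine Finset.sum_congr rfl fun x _ => ?_
      rw [Finsupp.sum_of_support_subset _ (hφB p) _ (by simp), ← Finset.sum_coe_sort B]
      exact Finset.sum_congr rfl fun y _ => by rw [hφa, hφa]
    simp only [this]
    fun_prop
  obtain ⟨p, hp, hmin⟩ := (isCompact_stdSimplex ℝ B).exists_isMinOn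
    ⟨_, single_mem_stdSimplex ℝ (Classical.arbitrary B)⟩ hcont.continuousOn
  refine ⟨φ p, hφB p, hφ0 p hp.1, (hφm p).trans hp.2, fun v hv hv0 hv1 => ?_⟩
  have hmem : (fun x : B => v x) ∈ stdSimplex ℝ B :=
    ⟨fun x => hv0 x, by rw [← hφm, hφr v hv, hv1]⟩
  have h := hmin hmem
  simpa only [Set.mem_ofPred_eq, hφr v hv] using h

theorem finiteDiversifier_empty : finiteDiversifier (∅ : Finset X) = 0 := by
  rw [finiteDiversifier, dif_neg]
  rintro ⟨w, hw⟩
  exact hw.1.2.2 (Finsupp.support_eq_empty.1 (Finset.subset_empty.1 hw.1.1))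

/-! ### The kernel form as an inner product -/

variable [PositiveDefinite X]

theorem inner_toWeighting (u v : X →₀ ℝ) :
    inner ℝ (toWeighting u) (toWeighting v) = kernelForm u v := by
  rw [toWeighting, toWeighting, UniformSpace.Completion.inner_coe, FM.inner_of]

theorem norm_toWeighting_sq (u : X →₀ ℝ) : ‖toWeighting u‖ ^ 2 = kernelForm u u := by
  rw [← real_inner_self_eq_norm_sq, inner_toWeighting]

theorem toWeighting_add (u v : X →₀ ℝ) :
    toWeighting (u + v) = toWeighting u + toWeighting v := by
  rw [toWeighting, map_add, UniformSpace.Completion.coe_add]; rfl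

theorem toWeighting_sub (u v : X →₀ ℝ) :
    toWeighting (u - v) = toWeighting u - toWeighting v := by
  rw [toWeighting, map_sub, UniformSpace.Completion.coe_sub]; rfl

theorem toWeighting_smul (c : ℝ) (u : X →₀ ℝ) :
    toWeighting (c • u) = c • toWeighting u := by
  rw [toWeighting, map_smul, UniformSpace.Completion.coe_smul]; rfl

theorem kernelForm_comm (u v : X →₀ ℝ) : kernelForm u v = kernelForm v u := by
  rw [← inner_toWeighting, real_inner_comm, inner_toWeighting]

theorem kernelForm_smul_smul (c : ℝ) (u : X →₀ ℝ) :
    kernelForm (c • u) (c • u) = c ^ 2 * kernelForm u u := by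
  rw [← norm_toWeighting_sq, toWeighting_smul, norm_smul, mul_pow, norm_toWeighting_sq,
    Real.norm_eq_abs, sq_abs]

theorem kernelForm_add_smul (u v : X →₀ ℝ) (t : ℝ) :
    kernelForm (u + t • v) (u + t • v) =
      kernelForm u u + 2 * t * kernelForm u v + t ^ 2 * kernelForm v v := by
  rw [← norm_toWeighting_sq, toWeighting_add, toWeighting_smul, norm_add_sq_real, norm_smul,
    mul_pow, inner_smul_right, norm_toWeighting_sq, norm_toWeighting_sq, inner_toWeighting,
    Real.norm_eq_abs, sq_abs]
  ring

/-! ### Diversifiers of finite sets -/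

theorem IsFiniteDiversifier.kernelForm_self {B : Finset X} {w : X →₀ ℝ}
    (hw : IsFiniteDiversifier B w) : kernelForm w w = mass w := by
  have hm := mass_pos hw.1.2.1 hw.1.2.2
  have hK := kernelForm_pos hw.1.2.2
  have h := hw.2.2
  rw [diversity, eq_div_iff hK.ne', sq] at h
  exact mul_left_cancel₀ hm.ne' h

/-- The first-order optimality condition for the diversifier of a finite set. -/
theorem IsFiniteDiversifier.mass_le_kernelForm {B : Finset X} {w v : X →₀ ℝ}
    (hw : IsFiniteDiversifier B w) (hv : 0 ≤ v) (hvB : v.support ⊆ B) :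
    mass v ≤ kernelForm w v := by
  classical
  have hm := mass_pos hw.1.2.1 hw.1.2.2
  have hKw := hw.kernelForm_self
  -- Compare `w` with its perturbation `w + t • v`, drop the term `(t * mass v)²` and divide by `2 *
  -- t`; then let `t` tend to `0`.
  have key : ∀ t : ℝ, 0 < t →
      mass w * (mass v - kernelForm w v) ≤ t * (mass w * kernelForm v v / 2) := by
    intro t ht
    have hmass : mass (w + t • v) = mass w + t * mass v := by rw [mass_add, mass_smul]
    have hpos : 0 < mass (w + t • v) := by
      rw [hmass]; exact add_pos_of_pos_of_nonneg hm (mul_nonneg ht.le (mass_nonneg hv))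
    have hne : w + t • v ≠ 0 := by
      intro h0
      simp [h0, mass] at hpos
    have hfeas : Feasible B (w + t • v) := by
      refine ⟨?_, add_nonneg hw.1.2.1 (smul_nonneg ht.le hv), hne⟩
      refine Finsupp.support_add.trans (Finset.union_subset hw.1.1 ?_)
      exact Finsupp.support_smul.trans hvB
    have h := hw.2.1 _ hfeas
    rw [← hw.2.2, diversity, div_le_iff₀ (kernelForm_pos hne), hmass, kernelForm_add_smul,
      hKw] at h
    have h2 : t * (mass w * (mass v - kernelForm w v)) ≤
        t * (t * (mass w * kernelForm v v / 2)) := by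
      nlinarith [sq_nonneg (t * mass v)]
    exact le_of_mul_le_mul_left h2 ht
  have hlim : Filter.Tendsto (fun t : ℝ => t * (mass w * kernelForm v v / 2))
      (nhdsWithin 0 (Set.Ioi 0)) (nhds 0) := by
    have : Filter.Tendsto (fun t : ℝ => t * (mass w * kernelForm v v / 2)) (nhds 0)
        (nhds (0 * (mass w * kernelForm v v / 2))) := by
      exact (continuous_id.mul continuous_const).tendsto 0
    rw [zero_mul] at this
    exact this.mono_left nhdsWithin_le_nhds
  have h0 := ge_of_tendsto hlim (Filter.eventually_of_mem self_mem_nhdsWithin fun t ht => key t ht)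
  nlinarith

/-- By optimality both masses are at most `⟨w, w'⟩`, so `‖w - w'‖² = mass w + mass w' - 2⟨w, w'⟩ ≤
0`. -/
theorem IsFiniteDiversifier.eq {B : Finset X} {w w' : X →₀ ℝ}
    (hw : IsFiniteDiversifier B w) (hw' : IsFiniteDiversifier B w') : w = w' := by
  by_contra hne
  have hpos := kernelForm_pos (sub_ne_zero.2 hne)
  have h1 := hw.mass_le_kernelForm hw'.1.2.1 hw'.1.1
  have h2 := hw'.mass_le_kernelForm hw.1.2.1 hw.1.1
  rw [kernelForm_comm] at h2
  rw [← norm_toWeighting_sq, toWeighting_sub, norm_sub_sq_real, norm_toWeighting_sq,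
    norm_toWeighting_sq, inner_toWeighting, hw.kernelForm_self, hw'.kernelForm_self] at hpos
  linarith

/-- The quotient is invariant under scaling, so it suffices to minimize the energy at mass `1`;
rescaling by the inverse energy makes the mass equal to the maximum. -/
theorem exists_isFiniteDiversifier {B : Finset X} (hB : B.Nonempty) :
    ∃ w, IsFiniteDiversifier B w := by
  classical
  obtain ⟨u, huB, hu0, hu1, hmin⟩ := exists_minimizer_kernelForm hB
  have hune : u ≠ 0 := by
    rintro rfl
    simp [mass] at hu1
  have hK := kernelForm_pos hune
  set c := (kernelForm u u)⁻¹ with hc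
  have hcpos : 0 < c := inv_pos.2 hK
  have hdiv : diversity (c • u) = c := by
    rw [diversity, kernelForm_smul_smul, mass_smul, hu1, mul_one, hc]
    field_simp
  refine ⟨c • u, ⟨Finsupp.support_smul.trans huB, smul_nonneg hcpos.le hu0,
    smul_ne_zero hcpos.ne' hune⟩, fun v hv => ?_, by rw [hdiv, mass_smul, hu1, mul_one]⟩
  have hvm := mass_pos hv.2.1 hv.2.2
  have h := hmin ((mass v)⁻¹ • v) (Finsupp.support_smul.trans hv.1)
    (smul_nonneg (inv_pos.2 hvm).le hv.2.1) (by rw [mass_smul, inv_mul_cancel₀ hvm.ne'])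
  rw [kernelForm_smul_smul] at h
  rw [hdiv, diversity, div_le_iff₀ (kernelForm_pos hv.2.2), hc, inv_mul_eq_div, le_div_iff₀ hK]
  calc mass v ^ 2 * kernelForm u u
      ≤ mass v ^ 2 * ((mass v)⁻¹ ^ 2 * kernelForm v v) :=
        mul_le_mul_of_nonneg_left h (sq_nonneg _)
    _ = kernelForm v v := by field_simp

theorem isFiniteDiversifier_finiteDiversifier {B : Finset X} (hB : B.Nonempty) :
    IsFiniteDiversifier B (finiteDiversifier B) := by
  rw [finiteDiversifier, dif_pos (exists_isFiniteDiversifier hB)]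
  exact (exists_isFiniteDiversifier hB).choose_spec

theorem finiteDiversifier_nonneg (B : Finset X) : 0 ≤ finiteDiversifier B := by
  rcases B.eq_empty_or_nonempty with rfl | hB
  · rw [finiteDiversifier_empty]
  · exact (isFiniteDiversifier_finiteDiversifier hB).1.2.1

theorem support_finiteDiversifier_subset (B : Finset X) : (finiteDiversifier B).support ⊆ B := by
  rcases B.eq_empty_or_nonempty with rfl | hB
  · simp [finiteDiversifier_empty]
  · exact (isFiniteDiversifier_finiteDiversifier hB).1.1

theorem kernelForm_finiteDiversifier_self (B : Finset X) :
    kernelForm (finiteDiversifier B) (finiteDiversifier B) = mass (finiteDiversifier B) := by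
  rcases B.eq_empty_or_nonempty with rfl | hB
  · simp [finiteDiversifier_empty, kernelForm, mass]
  · exact (isFiniteDiversifier_finiteDiversifier hB).kernelForm_self

theorem one_le_potential_finiteDiversifier {B : Finset X} {x : X} (hx : x ∈ B) :
    1 ≤ potential (finiteDiversifier B) x := by
  have h := (isFiniteDiversifier_finiteDiversifier ⟨x, hx⟩).mass_le_kernelForm
    (v := Finsupp.single x 1) (Finsupp.single_nonneg.2 zero_le_one)
    (Finsupp.support_single_subset.trans (Finset.singleton_subset_iff.2 hx))
  rwa [kernelForm_single_right, mass, Finsupp.sum_single_index rfl] at h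

/-- If every point of `C` is within distance `r` of `B`, then
`e^{-r} ‖w_{C,+}‖² ≤ ⟨w_{B,+}, w_{C,+}⟩`. -/
theorem exp_neg_mul_norm_sq_le_inner {B C : Finset X} {r : ℝ}
    (h : ∀ c ∈ C, ∃ b ∈ B, dist c b ≤ r) :
    Real.exp (-r) * ‖toWeighting (finiteDiversifier C)‖ ^ 2 ≤
      inner ℝ (toWeighting (finiteDiversifier B)) (toWeighting (finiteDiversifier C)) := by
  rw [norm_toWeighting_sq, inner_toWeighting, kernelForm_finiteDiversifier_self]
  refine mul_mass_le_kernelForm (finiteDiversifier_nonneg C) fun x hx => ?_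
  obtain ⟨b, hb, hr⟩ := h x (support_finiteDiversifier_subset C hx)
  calc Real.exp (-r) ≤ Real.exp (-dist x b) * 1 := by
        rw [mul_one]; exact Real.exp_le_exp.2 (neg_le_neg hr)
    _ ≤ Real.exp (-dist x b) * potential (finiteDiversifier B) b :=
        mul_le_mul_of_nonneg_left (one_le_potential_finiteDiversifier hb) (Real.exp_pos _).le
    _ ≤ _ := exp_neg_dist_mul_potential_le (finiteDiversifier_nonneg B) x b

/-- Cauchy–Schwarz, then cancel `‖w‖`. -/
theorem norm_le_exp_mul_norm {E : Type*} [NormedAddCommGroup E] [InnerProductSpace ℝ E]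
    {v w : E} {r : ℝ} (h : Real.exp (-r) * ‖w‖ ^ 2 ≤ inner ℝ v w) :
    ‖w‖ ≤ Real.exp r * ‖v‖ := by
  rcases (norm_nonneg w).eq_or_lt with h0 | hpos
  · rw [← h0]; positivity
  · have h1 : Real.exp (-r) * ‖w‖ * ‖w‖ ≤ ‖v‖ * ‖w‖ := by
      have := h.trans (real_inner_le_norm v w)
      rwa [sq, ← mul_assoc] at this
    have h2 := mul_le_mul_of_nonneg_left (le_of_mul_le_mul_right h1 hpos) (Real.exp_pos r).le
    rwa [← mul_assoc, ← Real.exp_add, add_neg_cancel, Real.exp_zero, one_mul] at h2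

theorem dist_sq_le_of_subset {B C : Finset X} (h : B ⊆ C) :
    dist (toWeighting (finiteDiversifier C)) (toWeighting (finiteDiversifier B)) ^ 2 ≤
      ‖toWeighting (finiteDiversifier C)‖ ^ 2 - ‖toWeighting (finiteDiversifier B)‖ ^ 2 := by
  have h1 := exp_neg_mul_norm_sq_le_inner (B := C) (C := B) (r := 0)
    fun c hc => ⟨c, h hc, (dist_self c).le⟩
  rw [neg_zero, Real.exp_zero, one_mul] at h1
  rw [dist_eq_norm, norm_sub_sq_real]
  linarith

/-! ### Convergence of the net for a compact set -/

theorem exists_norm_finiteDiversifier_le (A : TopologicalSpace.Compacts X) :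
    ∃ M : ℝ, ∀ B : Finset X, (B : Set X) ⊆ A → ‖toWeighting (finiteDiversifier B)‖ ≤ M := by
  -- A finite `1`-net serves as one comparison set for all `B`, whence the factor `e`.
  obtain ⟨t, -, htfin, hcov⟩ := A.isCompact.finite_cover_balls one_pos
  refine ⟨Real.exp 1 * ‖toWeighting (finiteDiversifier htfin.toFinset)‖, fun B hB => ?_⟩
  refine norm_le_exp_mul_norm (exp_neg_mul_norm_sq_le_inner fun c hc => ?_)
  obtain ⟨b, hb, hcb⟩ := Set.mem_iUnion₂.1 (hcov (hB hc))
  exact ⟨b, htfin.mem_toFinset.2 hb, (Metric.mem_ball.1 hcb).le⟩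

instance finiteSubsets_nonempty (A : Set X) : Nonempty {B : Finset X // (B : Set X) ⊆ A} :=
  ⟨⟨∅, by simp⟩⟩

instance finiteSubsets_isDirectedOrder (A : Set X) :
    IsDirectedOrder {B : Finset X // (B : Set X) ⊆ A} where
  directed B C := by
    classical
    exact ⟨⟨B.1 ∪ C.1, by simpa using ⟨B.2, C.2⟩⟩, Finset.subset_union_left,
      Finset.subset_union_right⟩

theorem cauchy_diversifierNet (A : TopologicalSpace.Compacts X) :
    Cauchy (Filter.map (diversifierNet (A : Set X)) Filter.atTop) := by
  obtain ⟨M, hM⟩ := exists_norm_finiteDiversifier_le A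
  let f : {B : Finset X // (B : Set X) ⊆ A} → ℝ := fun B => ‖diversifierNet (A : Set X) B‖ ^ 2
  have hbdd : BddAbove (Set.range f) := by
    refine ⟨M ^ 2, ?_⟩
    rintro _ ⟨B, rfl⟩
    exact pow_le_pow_left₀ (norm_nonneg _) (hM B.1 B.2) 2
  refine Metric.cauchy_iff.2 ⟨inferInstance, fun ε hε => ?_⟩
  -- Beyond a `B` that nearly attains the supremum, `dist_sq_le_of_subset` leaves no room to move.
  obtain ⟨B, hB⟩ := exists_lt_of_lt_ciSup
    (show (⨆ B, f B) - (ε / 2) ^ 2 < ⨆ B, f B from sub_lt_self _ (by positivity))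
  have hclose : ∀ C, B ≤ C →
      dist (diversifierNet (A : Set X) C) (diversifierNet (A : Set X) B) < ε / 2 := by
    intro C hC
    have h1 : dist (diversifierNet (A : Set X) C) (diversifierNet (A : Set X) B) ^ 2 ≤
      f C - f B := dist_sq_le_of_subset hC
    have h2 := le_ciSup hbdd C
    exact lt_of_pow_lt_pow_left₀ 2 (by positivity) (by linarith)
  refine ⟨_, Filter.image_mem_map (Filter.Ici_mem_atTop B), ?_⟩
  rintro _ ⟨C, hC, rfl⟩ _ ⟨D, hD, rfl⟩
  linarith [hclose C hC, hclose D hD, dist_triangle_right (diversifierNet (A : Set X) C)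
    (diversifierNet (A : Set X) D) (diversifierNet (A : Set X) B)]

theorem tendsto_diversifierNet (A : TopologicalSpace.Compacts X) :
    Filter.Tendsto (diversifierNet (A : Set X)) Filter.atTop (nhds (diversifier (A : Set X))) :=
  tendsto_nhds_limUnder (cauchy_map_iff_exists_tendsto.1 (cauchy_diversifierNet A))

/-! ### Continuity in the Hausdorff distance -/

theorem exp_neg_mul_norm_diversifier_sq_le_inner (A A' : TopologicalSpace.Compacts X) {r : ℝ}
    (h : ∀ a' ∈ A', ∃ a ∈ A, dist a' a ≤ r) :
    Real.exp (-r) * ‖diversifier (A' : Set X)‖ ^ 2 ≤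
      inner ℝ (diversifier (A : Set X)) (diversifier (A' : Set X)) := by
  classical
  have hA := tendsto_diversifierNet A
  have hA' := tendsto_diversifierNet A'
  refine le_of_tendsto_of_tendsto' ((hA'.norm.pow 2).const_mul _)
    (tendsto_const_nhds.inner hA') fun C => ?_
  -- With `C` fixed, the finite inequality holds for every `B` containing the nearby points `g c`,
  -- hence eventually in `B`.
  choose! g hgA hg using h
  refine ge_of_tendsto (hA.inner tendsto_const_nhds) ?_
  have hsub : ((C.1.image g : Finset X) : Set X) ⊆ A := by
    intro x hx
    obtain ⟨c, hc, rfl⟩ := Finset.mem_image.1 (Finset.mem_coe.1 hx)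
    exact hgA c (C.2 hc)
  filter_upwards [Filter.eventually_ge_atTop
    (⟨C.1.image g, hsub⟩ : {B : Finset X // (B : Set X) ⊆ A})] with B hB
  exact exp_neg_mul_norm_sq_le_inner fun c hc =>
    ⟨g c, hB (Finset.mem_image_of_mem g hc), hg c (C.2 hc)⟩

/-- The norm of `diversifier A'` is eliminated through `‖w_A'‖ ≤ e^r ‖w_A‖`, so that for fixed `A`
the bound depends on `r` alone and vanishes as `r` tends to `0`. -/
theorem dist_diversifier_sq_le (A A' : TopologicalSpace.Compacts X) {r : ℝ}
    (h : edist A' A < ENNReal.ofReal r) :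
    dist (diversifier (A' : Set X)) (diversifier (A : Set X)) ^ 2 ≤
      (1 - Real.exp (-r)) * (1 + Real.exp r ^ 2) * ‖diversifier (A : Set X)‖ ^ 2 := by
  have hr : 0 < r := ENNReal.ofReal_pos.1 (bot_le.trans_lt h)
  rw [TopologicalSpace.Compacts.edist_eq] at h
  have near : ∀ s t : TopologicalSpace.Compacts X,
      Metric.hausdorffEDist (s : Set X) t < ENNReal.ofReal r → ∀ x ∈ s, ∃ y ∈ t, dist x y ≤ r := by
    intro s t hst x hx
    obtain ⟨y, hy, hxy⟩ := Metric.exists_edist_lt_of_hausdorffEDist_lt hx hst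
    exact ⟨y, hy, (edist_lt_ofReal.1 hxy).le⟩
  have h1 := exp_neg_mul_norm_diversifier_sq_le_inner A A' (near A' A h)
  have h2 := exp_neg_mul_norm_diversifier_sq_le_inner A' A
    (near A A' (by rwa [Metric.hausdorffEDist_comm]))
  have h3 := pow_le_pow_left₀ (norm_nonneg _) (norm_le_exp_mul_norm h1) 2
  rw [mul_pow] at h3
  have h4 : 0 ≤ 1 - Real.exp (-r) := by
    rw [sub_nonneg, Real.exp_le_one_iff]; linarith
  rw [dist_eq_norm, norm_sub_sq_real]
  rw [real_inner_comm] at h1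
  nlinarith [mul_le_mul_of_nonneg_left h3 h4]

theorem continuous_diversifier :
    Continuous fun A : TopologicalSpace.Compacts X => diversifier (A : Set X) := by
  refine continuous_iff_continuousAt.2 fun A => Metric.tendsto_nhds.2 fun ε hε => ?_
  have hlim : Filter.Tendsto (fun r : ℝ => (1 - Real.exp (-r)) * (1 + Real.exp r ^ 2) *
      ‖diversifier (A : Set X)‖ ^ 2) (nhdsWithin 0 (Set.Ioi 0)) (nhds 0) := by
    have hc : Continuous fun r : ℝ => (1 - Real.exp (-r)) * (1 + Real.exp r ^ 2) *
      ‖diversifier (A : Set X)‖ ^ 2 := by fun_prop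
    have h0 := hc.tendsto 0
    simp only [neg_zero, Real.exp_zero, sub_self, zero_mul] at h0
    exact h0.mono_left nhdsWithin_le_nhds
  obtain ⟨r, hrε, hr⟩ := ((hlim.eventually_lt_const (pow_pos hε 2)).and
    self_mem_nhdsWithin).exists
  filter_upwards [Metric.eball_mem_nhds A (ENNReal.ofReal_pos.2 hr)] with A' hA'
  exact lt_of_pow_lt_pow_left₀ 2 hε.le ((dist_diversifier_sq_le A A' hA').trans_lt hrε)

end Diversity


/-- The first two conjuncts say that the diversifiers of finite sets and of compact sets are
well defined. The topology on `TopologicalSpace.Compacts X` is the one of the Hausdorff distance. -/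
theorem mainTheorem9 (X : Type*) [MetricSpace X] [Diversity.PositiveDefinite X] :
    (∀ B : Finset X, B.Nonempty → ∃! w : X →₀ ℝ, Diversity.IsFiniteDiversifier B w) ∧
    (∀ A : TopologicalSpace.Compacts X,
      Filter.Tendsto (Diversity.diversifierNet (A : Set X)) Filter.atTop
        (nhds (Diversity.diversifier (A : Set X)))) ∧
    ∀ h : Diversity.KernelSpace X,
      Continuous fun A : TopologicalSpace.Compacts X =>
        Diversity.pairing (Diversity.diversifier (A : Set X)) h := by
  refine ⟨fun B hB => ?_, Diversity.tendsto_diversifierNet, fun h => ?_⟩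
  · obtain ⟨w, hw⟩ := Diversity.exists_isFiniteDiversifier hB
    exact ⟨w, hw, fun _ hw' => hw'.eq hw⟩
  · exact ((Diversity.similarityMap X).continuous.comp
      Diversity.continuous_diversifier).inner continuous_const
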